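/- Call a real function $\varphi$ defined on a set $D\subseteq\mathbb{R}$ \emph{globally regular} if at least one of the following holds: (i) $\varphi$ is bounded on some Lebesgue measurable subset of $D$ of positive measure; (ii) $\varphi$ is continuous on $D$; (iii) there is a Lebesgue measurable subset of $D$ of positive measure such that the restriction of $\varphi$ to it is Lebesgue measurable. A \emph{derivation} is a function $F\colon\mathbb{R}\to\mathbb{R}$ with $F(x+y)=F(x)+F(y)$ and $F(xy)=xF(y)+F(x)y$ for all $x,y\in\mathbb{R}$. Theorem. Let $n\in\mathbb{Z}\setminus\{0\}$ and let $\begin{pmatrix}a&b\\c&d\end{pmatrix}\in\mathbf{GL}_2(\mathbb{Q})$ be such that $n\neq 1$ if $c=0$, and $n\neq -1$ if $d=0$. Let $f,g\colon\mathbb{R}\to\mathbb{R}$ be additive functions, and define \[ \varphi(x)=f\left(\frac{ax^{n}+b}{cx^{n}+d}\right)-\frac{x^{n-1}g(x)}{(cx^{n}+d)^{2}} \] on the set $D$ of all $x\in\mathbb{R}$ (with $x\neq 0$ if $n<0$) such that $cx^{n}+d\neq 0$. If $\varphi$ is globally regular on $D$, then the functions $F,G\colon\mathbb{R}\to\mathbb{R}$,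 \[ F(x)=f(x)-f(1)x,\qquad G(x)=g(x)-g(1)x\qquad(x\in\mathbb{R}), \] are derivations. -/

import Mathlib

open MeasureTheory
open scoped MatrixGroups

/-- `φ`, regarded as a real function with domain `D`, is globally regular: it is bounded on a
Lebesgue measurable subset of `D` of positive measure, or continuous on `D`, or its restriction
to some subset of `D` of positive Lebesgue measure is Lebesgue measurable.
Lebesgue measurable sets are the null measurable sets of the Lebesgue measure `volume`. -/
def IsGloballyRegularOn (φ : ℝ → ℝ) (D : Set ℝ) : Prop :=
  (∃ A ⊆ D, NullMeasurableSet A volume ∧ 0 < volume A ∧ ∃ C : ℝ, ∀ x ∈ A, |φ x| ≤ C) ∨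
  ContinuousOn φ D ∨
  (∃ A ⊆ D, NullMeasurableSet A volume ∧ 0 < volume A ∧
    ∀ B : Set ℝ, MeasurableSet B → NullMeasurableSet (A ∩ φ ⁻¹' B) volume)

/-- A derivation of the real line: an additive function satisfying the Leibniz rule. -/
def IsRealDerivation (F : ℝ → ℝ) : Prop :=
  (∀ x y, F (x + y) = F x + F y) ∧ ∀ x y, F (x * y) = x * F y + F x * y

/-- The set of real `x` for which `x ^ n` is defined and `c x ^ n + d ≠ 0`, where `(c, d)` is the
bottom row of `M`. -/
def rationalDomain (M : GL (Fin 2) ℚ) (n : ℤ) : Set ℝ :=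
  {x | (n < 0 → x ≠ 0) ∧ (M 1 0 : ℝ) * x ^ n + (M 1 1 : ℝ) ≠ 0}

/-- The function `f ((a x ^ n + b) / (c x ^ n + d)) - x ^ (n - 1) g(x) / (c x ^ n + d) ^ 2` for the
matrix `M = (a b; c d)`; it is only used on `rationalDomain M n`. -/
noncomputable def rationalDefect (M : GL (Fin 2) ℚ) (n : ℤ) (f g : ℝ → ℝ) (x : ℝ) : ℝ :=
  f (((M 0 0 : ℝ) * x ^ n + (M 0 1 : ℝ)) / ((M 1 0 : ℝ) * x ^ n + (M 1 1 : ℝ))) -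
    x ^ (n - 1) * g x / ((M 1 0 : ℝ) * x ^ n + (M 1 1 : ℝ)) ^ 2

/-! Each kind of regularity bounds φ on a compact set K of positive measure lying on one side of 0.
Rational Möbius changes then leave three models: f(z^n) - z^(n-1) g(z), f(z^n) - z^(n+1) g(1/z), and
f(1/(x^n + δ)) - x^(n-1) g(x)/(x^n + δ)^2 with δ ≠ 0.

The first two are homogeneous under rational dilations, and the rational dilates of K cover almost
every real (`ae_exists_rat_mul_mem`), so the bound on K becomes an essential bound on every bounded
set. Putting q + z for z, with q natural, gives a polynomial in q whose coefficients inherit such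
bounds (`LocBddAE.coeff`). Eliminating g between bounded expressions leaves f(z^2) - 2z f(z). Its
polarisation is additive in each variable, hence linear, and this is the Leibniz rule for F
(`isRealDerivation_of_locBddAE`).

The third model is not homogeneous, but comparing x with qx for a rational q ≠ 1 eliminates g and
leads to f(m) + m^2 f(1/m), an instance of the second model.

Finally F vanishes on ℚ, so the quotient rule shows that (ad - bc) n F - g is additive and bounded
on K, hence linear; thus G is a multiple of F. -/

/-! ### Positive measure and rational dilations -/

/-- Two sets of positive measure, one of which is stable under a dense set of translations, meet. -/
theorem volume_compl_eq_zero_of_dense_translations {S D : Set ℝ} (hS : MeasurableSet S)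
    (hD : Dense D) (hSD : ∀ d ∈ D, ∀ x ∈ S, d + x ∈ S) (hpos : volume S ≠ 0) :
    volume Sᶜ = 0 := by
  by_contra hN
  -- The shear (x, y) ↦ (x + y, y) preserves area; without such an a, Sᶜ × S would be null.
  obtain ⟨a, ha⟩ : ∃ a : ℝ, volume {y | y ∈ S ∧ a + y ∈ Sᶜ} ≠ 0 := by
    by_contra! h
    have hmp := measurePreserving_add_prod (volume : Measure ℝ) (volume : Measure ℝ)
    have h1 : ((volume : Measure ℝ).prod volume) {z : ℝ × ℝ | z.2 ∈ S ∧ z.1 + z.2 ∈ Sᶜ} = 0 := by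
      rw [Measure.measure_prod_null]
      · exact Filter.Eventually.of_forall fun a => h a
      · exact (measurable_snd hS).inter ((measurable_fst.add measurable_snd) hS.compl)
    have h2 := hmp.measure_preimage (s := Sᶜ ×ˢ S) (hS.compl.prod hS).nullMeasurableSet
    have h3 : (fun z : ℝ × ℝ => (z.1 + z.2, z.2)) ⁻¹' (Sᶜ ×ˢ S) =
        {z : ℝ × ℝ | z.2 ∈ S ∧ z.1 + z.2 ∈ Sᶜ} := by
      ext z
      simp [and_comm]
    rw [h3, h1, Measure.prod_prod] at h2
    exact mul_ne_zero hN hpos h2.symm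
  obtain ⟨K, hKs, hK, hKpos⟩ : ∃ K ⊆ {y | y ∈ S ∧ a + y ∈ Sᶜ}, IsCompact K ∧ 0 < volume K :=
    MeasurableSet.exists_lt_isCompact
      (hS.inter ((measurable_const.add measurable_id) hS.compl)) (pos_iff_ne_zero.2 ha)
  -- Steinhaus: K - K is a neighbourhood of 0, so some d in D near a satisfies d - a = y - y' with
  -- y, y' in K.
  have hst := Measure.sub_mem_nhds_zero_of_addHaar_pos volume K hK.measurableSet hKpos
  have hcont : Filter.Tendsto (fun d : ℝ => d - a) (nhds a) (nhds 0) := by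
    have : Continuous fun d : ℝ => d - a := by fun_prop
    simpa using this.tendsto a
  obtain ⟨d, hd, hdD⟩ := mem_closure_iff_nhds.1 (hD a) _ (hcont hst)
  obtain ⟨y, hy, y', hy', hyy⟩ := hd
  refine (hKs hy).2 ?_
  have : a + y = d + y' := by
    simp only at hyy
    linarith
  rw [this]
  exact hSD d hdD y' (hKs hy').1

theorem volume_image_pos {A : Set ℝ} {T T' : ℝ → ℝ} (hA : MeasurableSet A) (hpos : 0 < volume A)
    (hT : ∀ x ∈ A, HasDerivAt T (T' x) x) (hne : ∀ x ∈ A, T' x ≠ 0) (hinj : Set.InjOn T A) :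
    0 < volume (T '' A) := by
  have h := lintegral_image_eq_lintegral_abs_deriv_mul hA
    (fun x hx => (hT x hx).hasDerivWithinAt) hinj (fun _ => 1)
  rw [pos_iff_ne_zero]
  intro h0
  simp only [lintegral_const, MeasurableSet.univ, Measure.restrict_apply, Set.univ_inter, h0,
    mul_zero, mul_one] at h
  -- `T'` need not be measurable, whereas `deriv T` always is.
  have hd : ∀ x ∈ A, T' x = deriv T x := fun x hx => ((hT x hx).deriv).symm
  rw [setLIntegral_congr_fun hA (fun x hx => by rw [hd x hx] :
    ∀ x ∈ A, ENNReal.ofReal |T' x| = ENNReal.ofReal |deriv T x|)] at h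
  have h2 := (setLIntegral_eq_zero_iff hA
    ((measurable_deriv T).norm.ennreal_ofReal)).1 h.symm
  refine hpos.ne' (measure_mono_null (fun x hx => ?_) h2)
  simp only [Set.mem_compl_iff, Set.mem_ofPred_eq, Classical.not_imp]
  refine ⟨hx, ?_⟩
  rw [← hd x hx]
  simpa using hne x hx

theorem volume_eq_zero_of_exp_preimage {T : Set ℝ} (hsymm : ∀ x ∈ T, -x ∈ T)
    (h : volume (Real.exp ⁻¹' T) = 0) : volume T = 0 := by
  have h1 : volume (Real.exp '' (Real.exp ⁻¹' T)) = 0 :=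
    addHaar_image_eq_zero_of_differentiableOn_of_addHaar_eq_zero volume
      Real.differentiable_exp.differentiableOn h
  have h2 : volume ((fun x => -Real.exp x) '' (Real.exp ⁻¹' T)) = 0 :=
    addHaar_image_eq_zero_of_differentiableOn_of_addHaar_eq_zero volume
      Real.differentiable_exp.neg.differentiableOn h
  have h3 : volume ({0} : Set ℝ) = 0 := by simp
  refine measure_mono_null (fun x hx => ?_) (measure_union_null (measure_union_null h1 h2) h3)
  rcases lt_trichotomy x 0 with hx0 | rfl | hx0
  · refine Or.inl (Or.inr ⟨Real.log (-x), ?_, ?_⟩)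
    · rw [Set.mem_preimage, Real.exp_log (neg_pos.2 hx0)]
      exact hsymm x hx
    · simp only [Real.exp_log (neg_pos.2 hx0), neg_neg]
  · exact Or.inr rfl
  · exact Or.inl (Or.inl ⟨Real.log x, by simpa [Real.exp_log hx0] using hx, Real.exp_log hx0⟩)

/-- In the coordinate log x, dilations by positive rationals are translations by a dense set;
negative r make the set symmetric, which covers x < 0. -/
theorem ae_exists_rat_mul_mem {A : Set ℝ} (hA : MeasurableSet A) (hpos : 0 < volume A) :
    ∀ᵐ x : ℝ, ∃ r : ℚ, r ≠ 0 ∧ (r : ℝ) * x ∈ A := by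
  set S : Set ℝ := {x | ∃ r : ℚ, r ≠ 0 ∧ (r : ℝ) * x ∈ A} with hSdef
  have hSm : MeasurableSet S := by
    have : S = ⋃ r : ℚ, ⋃ _ : r ≠ 0, (fun x : ℝ => (r : ℝ) * x) ⁻¹' A := by
      ext x
      simp [hSdef]
    rw [this]
    exact MeasurableSet.iUnion fun r => MeasurableSet.iUnion fun _ =>
      (measurable_const.mul measurable_id) hA
  have hsymm : ∀ x ∈ S, -x ∈ S := by
    rintro x ⟨r, hr, hx⟩
    exact ⟨-r, neg_ne_zero.2 hr, by simpa using hx⟩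
  have hsymm' : ∀ x ∈ Sᶜ, -x ∈ Sᶜ := fun x hx h => hx (by simpa using hsymm _ h)
  have hAS : A ⊆ S := fun x hx => ⟨1, one_ne_zero, by simpa using hx⟩
  have hSpos : volume (Real.exp ⁻¹' S) ≠ 0 := fun h =>
    hpos.ne' (measure_mono_null hAS (volume_eq_zero_of_exp_preimage hsymm h))
  have hD : Dense {d : ℝ | ∃ q : ℚ, 0 < q ∧ Real.exp d = q} := by
    rw [dense_iff_exists_between]
    intro a b hab
    obtain ⟨q, hq1, hq2⟩ := exists_rat_btwn (Real.exp_lt_exp.2 hab)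
    have hq : (0 : ℝ) < q := (Real.exp_pos a).trans hq1
    refine ⟨Real.log q, ⟨q, by exact_mod_cast hq, Real.exp_log hq⟩, ?_, ?_⟩
    · exact (Real.lt_log_iff_exp_lt hq).2 hq1
    · exact (Real.log_lt_iff_lt_exp hq).2 hq2
  have hnull : volume (Real.exp ⁻¹' S)ᶜ = 0 := by
    refine volume_compl_eq_zero_of_dense_translations (Real.measurable_exp hSm) hD ?_ hSpos
    rintro d ⟨q, hq, hdq⟩ x ⟨r, hr, hx⟩
    refine ⟨r / q, div_ne_zero hr hq.ne', ?_⟩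
    have hq' : (q : ℝ) ≠ 0 := by exact_mod_cast hq.ne'
    rw [Real.exp_add, hdq]
    push_cast
    rwa [show (r : ℝ) / q * (q * Real.exp x) = r * Real.exp x by field_simp]
  exact volume_eq_zero_of_exp_preimage hsymm' hnull

/-- Boundedness of a real function on a set. -/
def BddOn (A : Set ℝ) (φ : ℝ → ℝ) : Prop := ∃ C, ∀ x ∈ A, |φ x| ≤ C

/-- Almost every x has a rational multiple rx in A. Since A stays away from 0, |r| is at least a
constant over |x|, which turns the bound at rx into one at x. -/
theorem BddOn.ae_le_of_homogeneous {A : Set ℝ} {φ : ℝ → ℝ} (hA : IsCompact A)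
    (hpos : 0 < volume A) (h0 : (0 : ℝ) ∉ A) (k : ℕ)
    (hφ : ∀ (r : ℚ) (x : ℝ), r ≠ 0 → x ≠ 0 → φ (r * x) = (r : ℝ) ^ k * φ x) (hb : BddOn A φ) :
    ∃ C, ∀ᵐ x : ℝ, |φ x| ≤ C * |x| ^ k := by
  obtain ⟨C, hC⟩ := hb
  obtain ⟨ε, hε, hεA⟩ : ∃ ε > 0, ∀ x ∈ A, ε ≤ |x| := by
    obtain ⟨ε, hε, h⟩ := Metric.isOpen_iff.1 hA.isClosed.isOpen_compl 0 h0
    refine ⟨ε, hε, fun x hx => ?_⟩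
    by_contra! hlt
    exact h (by simpa using hlt) hx
  refine ⟨|C| / ε ^ k, ?_⟩
  filter_upwards [ae_exists_rat_mul_mem hA.measurableSet hpos] with x ⟨r, hr, hx⟩
  have hr' : (r : ℝ) ≠ 0 := by exact_mod_cast hr
  have hx0 : x ≠ 0 := by
    rintro rfl
    exact h0 (by simpa using hx)
  have h1 := (hC _ hx).trans (le_abs_self C)
  have h2 := hεA _ hx
  rw [hφ r x hr hx0, abs_mul, abs_pow] at h1
  rw [abs_mul] at h2
  have h3 : ε ^ k ≤ |(r : ℝ)| ^ k * |x| ^ k := by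
    rw [← mul_pow]
    exact pow_le_pow_left₀ hε.le h2 k
  rw [div_mul_eq_mul_div, le_div_iff₀ (pow_pos hε k)]
  calc |φ x| * ε ^ k ≤ |φ x| * (|(r : ℝ)| ^ k * |x| ^ k) := by gcongr
    _ = |(r : ℝ)| ^ k * |φ x| * |x| ^ k := by ring
    _ ≤ |C| * |x| ^ k := by gcongr

/-- Pigeonhole: infinitely many dilates of A by factors in [1/2, 1] lie in one ball and have measure
at least half that of A, so two of them overlap. -/
theorem exists_rat_dilation_inter_pos {A : Set ℝ} (hA : IsCompact A) (hpos : 0 < volume A) :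
    ∃ q : ℚ, 0 < q ∧ q ≠ 1 ∧ 0 < volume (A ∩ (fun x => (q : ℝ) * x) ⁻¹' A) := by
  set r : ℕ → ℚ := fun i => 1 + 1 / (i + 1) with hrdef
  have hr1 : ∀ i, 1 ≤ r i := fun i => by
    simp only [hrdef]
    linarith [show (0 : ℚ) ≤ 1 / (i + 1) by positivity]
  have hr0 : ∀ i, 0 < r i := fun i => one_pos.trans_le (hr1 i)
  have hr2 : ∀ i, r i ≤ 2 := fun i => by
    have : (1 : ℚ) / (i + 1) ≤ 1 := by
      rw [div_le_one (by positivity)]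
      linarith [show (0 : ℚ) ≤ i by positivity]
    simp only [hrdef]
    linarith
  have hrinj : ∀ i j, r i = r j → i = j := fun i j h => by
    simp only [hrdef, add_right_inj, one_div, inv_inj, add_left_inj] at h
    exact_mod_cast h
  let As : ℕ → Set ℝ := fun i => (fun x => ((r i : ℚ) : ℝ) * x) ⁻¹' A
  have hAm : ∀ i, MeasurableSet (As i) := fun i =>
    (measurable_const.mul measurable_id) hA.measurableSet
  have hscale : ∀ i (B : Set ℝ), volume ((fun x => ((r i : ℚ) : ℝ) * x) ⁻¹' B) =
      ENNReal.ofReal |((r i : ℚ) : ℝ)⁻¹| * volume B := fun i B =>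
    Real.volume_preimage_mul_left (by exact_mod_cast (hr0 i).ne') B
  by_cases hdisj : Pairwise (Function.onFun (AEDisjoint volume) As)
  · exfalso
    have h1 := tsum_meas_le_meas_iUnion_of_disjoint₀ volume
      (fun i => (hAm i).nullMeasurableSet) hdisj
    obtain ⟨R, hR⟩ := hA.isBounded.subset_closedBall 0
    have h2 : volume (⋃ i, As i) < ⊤ := by
      refine (measure_mono (t := Metric.closedBall 0 R) ?_).trans_lt measure_closedBall_lt_top
      refine Set.iUnion_subset fun i x hx => ?_
      have := hR hx
      simp only [Metric.mem_closedBall, dist_zero_right, Real.norm_eq_abs, abs_mul] at this ⊢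
      have h3 : (1 : ℝ) ≤ |((r i : ℚ) : ℝ)| := le_trans (by exact_mod_cast hr1 i) (le_abs_self _)
      nlinarith [abs_nonneg x]
    have h3 : ∀ i, ENNReal.ofReal (1 / 2) * volume A ≤ volume (As i) := fun i => by
      rw [hscale]
      gcongr
      have ha : (0 : ℝ) < r i := by exact_mod_cast hr0 i
      rw [abs_of_pos (inv_pos.2 ha), one_div]
      exact inv_anti₀ ha (by exact_mod_cast hr2 i)
    have h4 : ENNReal.ofReal (1 / 2) * volume A ≠ 0 := by
      refine mul_ne_zero ?_ hpos.ne'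
      simp
    have h5 := (ENNReal.tsum_le_tsum h3).trans h1
    rw [ENNReal.tsum_const_eq_top_of_ne_zero h4] at h5
    exact (h2.trans_le h5).false
  · simp only [Pairwise, not_forall, Function.onFun, AEDisjoint] at hdisj
    obtain ⟨i, j, hij, h⟩ := hdisj
    refine ⟨r j / r i, div_pos (hr0 j) (hr0 i), fun h1 => hij (hrinj i j ?_), ?_⟩
    · rw [div_eq_one_iff_eq (hr0 i).ne'] at h1
      exact h1.symm
    · rw [pos_iff_ne_zero]
      intro h0
      refine h ?_
      have h5 := hscale i (A ∩ (fun x => ((r j / r i : ℚ) : ℝ) * x) ⁻¹' A)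
      rw [h0, mul_zero] at h5
      refine measure_mono_null ?_ h5
      rintro x ⟨hx1, hx2⟩
      refine ⟨hx1, ?_⟩
      have ha : (r i : ℝ) ≠ 0 := by exact_mod_cast (hr0 i).ne'
      simp only [Set.mem_preimage, As] at hx2 ⊢
      push_cast
      rwa [show (r j : ℝ) / r i * (r i * x) = r j * x by field_simp]

/-! ### From regularity to boundedness on a compact set -/

theorem exists_compact_subset_one_sign {A : Set ℝ} (hA : NullMeasurableSet A volume)
    (hpos : 0 < volume A) :
    ∃ K ⊆ A, IsCompact K ∧ 0 < volume K ∧ (K ⊆ Set.Ioi 0 ∨ K ⊆ Set.Iio 0) := by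
  obtain ⟨B, hBA, hB, hBe⟩ := hA.exists_measurable_subset_ae_eq
  have hBpos : 0 < volume B := by rwa [measure_congr hBe]
  have key : ∀ I : Set ℝ, MeasurableSet I → volume (B ∩ I) ≠ 0 →
      ∃ K ⊆ A, IsCompact K ∧ 0 < volume K ∧ K ⊆ I := fun I hI h => by
    obtain ⟨K, hK, hKc, hKp⟩ := MeasurableSet.exists_lt_isCompact (hB.inter hI)
      (pos_iff_ne_zero.2 h)
    exact ⟨K, fun x hx => hBA (hK hx).1, hKc, hKp, fun x hx => (hK hx).2⟩
  by_cases h1 : volume (B ∩ Set.Ioi 0) = 0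
  · by_cases h2 : volume (B ∩ Set.Iio 0) = 0
    · refine absurd (measure_mono_null ?_ (measure_union_null (measure_union_null h1 h2)
        (show volume ({0} : Set ℝ) = 0 by simp))) hBpos.ne'
      intro x hx
      rcases lt_trichotomy x 0 with hx0 | hx0 | hx0
      · exact Or.inl (Or.inr ⟨hx, hx0⟩)
      · exact Or.inr hx0
      · exact Or.inl (Or.inl ⟨hx, hx0⟩)
    · obtain ⟨K, h1, h2, h3, h4⟩ := key _ measurableSet_Iio h2
      exact ⟨K, h1, h2, h3, Or.inr h4⟩
  · obtain ⟨K, h1, h2, h3, h4⟩ := key _ measurableSet_Ioi h1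
    exact ⟨K, h1, h2, h3, Or.inl h4⟩

theorem exists_compact_bddOn_of_isGloballyRegularOn {φ : ℝ → ℝ} {D : Set ℝ}
    (hD : MeasurableSet D) (hDpos : 0 < volume D) (h : IsGloballyRegularOn φ D) :
    ∃ K ⊆ D, IsCompact K ∧ 0 < volume K ∧ (K ⊆ Set.Ioi 0 ∨ K ⊆ Set.Iio 0) ∧ BddOn K φ := by
  rcases h with ⟨A, hAD, hA, hpos, C, hC⟩ | hc | ⟨A, hAD, hA, hpos, hm⟩
  · obtain ⟨K, hK, hKc, hKp, hs⟩ := exists_compact_subset_one_sign hA hpos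
    exact ⟨K, hK.trans hAD, hKc, hKp, hs, C, fun x hx => hC x (hK hx)⟩
  · obtain ⟨K, hK, hKc, hKp, hs⟩ := exists_compact_subset_one_sign hD.nullMeasurableSet hDpos
    obtain ⟨C, hC⟩ := hKc.exists_bound_of_continuousOn (hc.mono hK)
    exact ⟨K, hK, hKc, hKp, hs, C, hC⟩
  -- The sets where |φ| ≤ N exhaust A, so one of them is not null.
  · obtain ⟨N, hN⟩ : ∃ N : ℕ, volume (A ∩ φ ⁻¹' Set.Icc (-N : ℝ) N) ≠ 0 := by
      by_contra! hN
      refine hpos.ne' (measure_mono_null (fun x hx => ?_) (measure_iUnion_null hN))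
      obtain ⟨N, hN⟩ := exists_nat_ge |φ x|
      exact Set.mem_iUnion.2 ⟨N, hx, abs_le.1 hN⟩
    obtain ⟨K, hK, hKc, hKp, hs⟩ := exists_compact_subset_one_sign
      (hm _ (measurableSet_Icc (a := (-N : ℝ)) (b := N))) (pos_iff_ne_zero.2 hN)
    exact ⟨K, fun x hx => hAD (hK hx).1, hKc, hKp, hs, N, fun x hx => abs_le.2 (hK hx).2⟩

/-! ### Interpolation and essential local boundedness -/

open Polynomial in
/-- The Lagrange interpolation formula for the coefficients of a polynomial of degree at most `d`
in terms of its values at `0, …, d`. -/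
theorem exists_coeff_eq_sum_eval (d k : ℕ) : ∃ c : Fin (d + 1) → ℝ, ∀ p : ℝ[X],
    p.natDegree ≤ d → p.coeff k = ∑ i, c i * p.eval ((i : ℕ) : ℝ) := by
  by_cases hk : k ≤ d
  · set V := Matrix.vandermonde fun i : Fin (d + 1) => ((i : ℕ) : ℝ) with hV
    have hdet : IsUnit V.det := by
      rw [isUnit_iff_ne_zero, hV, Matrix.det_vandermonde_ne_zero_iff]
      intro i j hij
      exact Fin.ext (by simpa using hij)
    refine ⟨fun i => V⁻¹ ⟨k, by omega⟩ i, fun p hp => ?_⟩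
    have h1 : (fun i : Fin (d + 1) => p.eval ((i : ℕ) : ℝ)) =
        V.mulVec fun j : Fin (d + 1) => p.coeff j := by
      ext i
      rw [eval_eq_sum_range' (Nat.lt_succ_of_le hp), Finset.sum_range]
      simp [hV, Matrix.mulVec, dotProduct, Matrix.vandermonde_apply, mul_comm]
    have h2 : V⁻¹.mulVec (fun i : Fin (d + 1) => p.eval ((i : ℕ) : ℝ)) =
        fun j : Fin (d + 1) => p.coeff j := by
      rw [h1, Matrix.mulVec_mulVec, Matrix.nonsing_inv_mul _ hdet, Matrix.one_mulVec]
    exact (congrFun h2 ⟨k, by omega⟩).symm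
  · exact ⟨0, fun p hp => by simp [coeff_eq_zero_of_natDegree_lt (by omega : p.natDegree < k)]⟩

/-- A real function is locally bounded almost everywhere if on every bounded set it is
essentially bounded. -/
def LocBddAE (φ : ℝ → ℝ) : Prop := ∀ R : ℝ, ∃ C, ∀ᵐ x : ℝ, |x| ≤ R → |φ x| ≤ C

namespace LocBddAE

variable {φ ψ : ℝ → ℝ}

theorem congr_ae (h : LocBddAE φ) (he : ∀ᵐ x : ℝ, φ x = ψ x) : LocBddAE ψ := fun R => by
  obtain ⟨C, hC⟩ := h R
  refine ⟨C, ?_⟩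
  filter_upwards [hC, he] with x h1 h2
  rwa [← h2]

theorem congr (h : LocBddAE φ) (he : ∀ x, φ x = ψ x) : LocBddAE ψ :=
  h.congr_ae (Filter.Eventually.of_forall he)

theorem of_continuous (h : Continuous φ) : LocBddAE φ := fun R => by
  obtain ⟨C, hC⟩ := (isCompact_closedBall (0 : ℝ) R).exists_bound_of_continuousOn h.continuousOn
  exact ⟨C, Filter.Eventually.of_forall fun x hx => hC x (by simpa using hx)⟩

theorem add (h1 : LocBddAE φ) (h2 : LocBddAE ψ) : LocBddAE fun x => φ x + ψ x := fun R => by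
  obtain ⟨C1, hC1⟩ := h1 R
  obtain ⟨C2, hC2⟩ := h2 R
  refine ⟨C1 + C2, ?_⟩
  filter_upwards [hC1, hC2] with x h1 h2 hx
  exact (abs_add_le _ _).trans (add_le_add (h1 hx) (h2 hx))

theorem mul (h1 : LocBddAE φ) (h2 : LocBddAE ψ) : LocBddAE fun x => φ x * ψ x := fun R => by
  obtain ⟨C1, hC1⟩ := h1 R
  obtain ⟨C2, hC2⟩ := h2 R
  refine ⟨C1 * C2, ?_⟩
  filter_upwards [hC1, hC2] with x h1 h2 hx
  rw [abs_mul]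
  exact mul_le_mul (h1 hx) (h2 hx) (abs_nonneg _) ((abs_nonneg _).trans (h1 hx))

theorem const_mul (c : ℝ) (h : LocBddAE φ) : LocBddAE fun x => c * φ x :=
  (of_continuous continuous_const).mul h

theorem sub (h1 : LocBddAE φ) (h2 : LocBddAE ψ) : LocBddAE fun x => φ x - ψ x :=
  (h1.add (h2.const_mul (-1))).congr fun x => by ring

theorem sum {ι : Type*} (s : Finset ι) {φ : ι → ℝ → ℝ} (h : ∀ i ∈ s, LocBddAE (φ i)) :
    LocBddAE fun x => ∑ i ∈ s, φ i x := by
  classical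
  induction s using Finset.induction_on with
  | empty => simpa using of_continuous continuous_const
  | insert i s hi ih =>
    simp only [Finset.sum_insert hi]
    exact (h i (Finset.mem_insert_self i s)).add
      (ih fun j hj => h j (Finset.mem_insert_of_mem hj))

theorem comp_of_preimage_null {T : ℝ → ℝ} (h : LocBddAE φ) (hT : Continuous T)
    (hnull : ∀ N : Set ℝ, volume N = 0 → volume (T ⁻¹' N) = 0) :
    LocBddAE fun x => φ (T x) := fun R => by
  obtain ⟨S, hS⟩ := (isCompact_closedBall (0 : ℝ) R).exists_bound_of_continuousOn hT.continuousOn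
  obtain ⟨C, hC⟩ := h S
  refine ⟨C, ?_⟩
  have h1 : ∀ᵐ x : ℝ, |T x| ≤ S → |φ (T x)| ≤ C := hnull _ hC
  filter_upwards [h1] with x hx hxR
  exact hx (hS x (by simpa using hxR))

theorem comp_add_left (h : LocBddAE φ) (s : ℝ) : LocBddAE fun x => φ (s + x) :=
  h.comp_of_preimage_null (by fun_prop) fun N hN => by
    rwa [measure_preimage_add]

theorem of_ae_le {k : ℕ} (h : ∃ C, ∀ᵐ x : ℝ, |φ x| ≤ C * |x| ^ k) : LocBddAE φ := by
  obtain ⟨C, hC⟩ := h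
  have h1 : LocBddAE fun x => C * |x| ^ k := of_continuous (by fun_prop)
  intro R
  obtain ⟨C', hC'⟩ := h1 R
  refine ⟨C', ?_⟩
  filter_upwards [hC, hC'] with x h1 h2 hx
  exact h1.trans ((le_abs_self _).trans (h2 hx))

open Polynomial in
/-- If a family of polynomials of bounded degree is locally bounded almost everywhere at each
natural number, then so are its coefficients. -/
theorem coeff {p : ℝ → ℝ[X]} {d : ℕ} (hd : ∀ z, (p z).natDegree ≤ d)
    (h : ∀ q : ℕ, LocBddAE fun z => (p z).eval (q : ℝ)) (k : ℕ) :
    LocBddAE fun z => (p z).coeff k := by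
  obtain ⟨c, hc⟩ := exists_coeff_eq_sum_eval d k
  exact (LocBddAE.sum Finset.univ fun (i : Fin (d + 1)) _ => (h (i : ℕ)).const_mul (c i)).congr
    fun z => (hc _ (hd z)).symm

end LocBddAE

/-- Completing the square, the preimage lies in the images of N under two square-root branches,
smooth off the vertex, together with the vertex. -/
theorem volume_preimage_mul_add_self_null (q : ℝ) (N : Set ℝ) (hN : volume N = 0) :
    volume ((fun z => z * (q + z)) ⁻¹' N) = 0 := by
  have hsqrt : DifferentiableOn ℝ (fun w => √(w + (q / 2) ^ 2)) (N ∩ {w | w + (q / 2) ^ 2 ≠ 0}) :=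
    fun w hw => ((differentiableAt_id.add_const _).sqrt hw.2).differentiableWithinAt
  have hN' : volume (N ∩ {w | w + (q / 2) ^ 2 ≠ 0}) = 0 :=
    measure_mono_null Set.inter_subset_left hN
  have h1 := addHaar_image_eq_zero_of_differentiableOn_of_addHaar_eq_zero volume
    (hsqrt.sub_const (q / 2)) hN'
  have h2 := addHaar_image_eq_zero_of_differentiableOn_of_addHaar_eq_zero volume
    (hsqrt.neg.sub_const (q / 2)) hN'
  have h3 : volume ({-(q / 2)} : Set ℝ) = 0 := by simp
  refine measure_mono_null (fun z hz => ?_) (measure_union_null (measure_union_null h1 h2) h3)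
  have hsq : z * (q + z) + (q / 2) ^ 2 = (z + q / 2) ^ 2 := by ring
  rcases lt_trichotomy (z + q / 2) 0 with hz0 | hz0 | hz0
  · refine Or.inl (Or.inr ⟨z * (q + z), ⟨hz, ?_⟩, ?_⟩)
    · rw [Set.mem_ofPred_eq, hsq]
      exact pow_ne_zero 2 hz0.ne
    · simp only [Pi.neg_apply, hsq, Real.sqrt_sq_eq_abs, abs_of_neg hz0]
      ring
  · exact Or.inr (by simp only [Set.mem_singleton_iff]; linarith)
  · refine Or.inl (Or.inl ⟨z * (q + z), ⟨hz, ?_⟩, ?_⟩)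
    · rw [Set.mem_ofPred_eq, hsq]
      exact pow_ne_zero 2 hz0.ne'
    · simp only [hsq, Real.sqrt_sq_eq_abs, abs_of_pos hz0]
      ring

/-! ### Additive functions under essential bounds -/

theorem AddMonoidHom.map_rat_mul_real (f : ℝ →+ ℝ) (r : ℚ) (x : ℝ) : f (r * x) = r * f x := by
  simpa [Rat.smul_def] using map_rat_smul f r x

theorem AddMonoidHom.map_nat_mul_real (f : ℝ →+ ℝ) (n : ℕ) (x : ℝ) : f (n * x) = n * f x := by
  simpa using f.map_rat_mul_real n x

/-- Writing u(y) = u(y + x) - u(x) with x outside a null set turns the essential bound into a true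
bound near 0, whence continuity. -/
theorem LocBddAE.map_eq_mul (u : ℝ →+ ℝ) (h : LocBddAE u) (x : ℝ) : u x = u 1 * x := by
  obtain ⟨C, hC⟩ := h 2
  have hb : ∀ y : ℝ, |y| ≤ 1 → |u y| ≤ 2 * C := fun y hy => by
    have hCy : ∀ᵐ x : ℝ, |y + x| ≤ 2 → |u (y + x)| ≤ C :=
      (measurePreserving_add_left volume y).quasiMeasurePreserving.ae hC
    obtain ⟨x, hx, h1, h2⟩ : ∃ x ∈ Set.Icc (0 : ℝ) 1,
        (|x| ≤ 2 → |u x| ≤ C) ∧ (|y + x| ≤ 2 → |u (y + x)| ≤ C) := by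
      by_contra! hno
      have h0 : volume (Set.Icc (0 : ℝ) 1) = 0 := by
        rw [measure_eq_zero_iff_ae_notMem]
        filter_upwards [hC, hCy] with x h1 h2 hx
        obtain ⟨h3, h4⟩ := hno x hx h1
        exact (h2 h3).not_gt h4
      simp at h0
    have hx1 : |x| ≤ 1 := abs_le.2 ⟨by linarith [hx.1], hx.2⟩
    have h3 := h1 (by linarith)
    have h4 := h2 ((abs_add_le y x).trans (by linarith))
    rw [map_add] at h4
    rw [abs_le] at *
    constructor <;> linarith
  have hcont : Continuous u := by
    refine u.continuous_of_isBounded_nhds_zero (Metric.closedBall_mem_nhds 0 one_pos) ?_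
    refine (Metric.isBounded_closedBall (x := (0 : ℝ)) (r := 2 * C)).subset ?_
    rintro _ ⟨y, hy, rfl⟩
    simpa using hb y (by simpa using hy)
  have := map_real_smul u hcont x 1
  simpa [mul_comm] using this

theorem BddOn.map_eq_mul {A : Set ℝ} (hA : IsCompact A) (hpos : 0 < volume A) (h0 : (0 : ℝ) ∉ A)
    (u : ℝ →+ ℝ) (h : BddOn A u) (x : ℝ) : u x = u 1 * x :=
  LocBddAE.map_eq_mul u (LocBddAE.of_ae_le (h.ae_le_of_homogeneous hA hpos h0 1
    fun r x _ _ => by rw [u.map_rat_mul_real, pow_one])) x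

theorem isRealDerivation_of_locBddAE (f : ℝ →+ ℝ) (h : LocBddAE fun z => f (z ^ 2) - 2 * z * f z) :
    IsRealDerivation fun x => f x - f 1 * x := by
  have key : ∀ x y, f (x * y) - x * f y - y * f x = -f 1 * y * x := fun x y => by
    let u : ℝ →+ ℝ :=
      { toFun := fun x => f (x * y) - x * f y - y * f x
        map_zero' := by simp
        map_add' := fun a b => by
          simp only [add_mul, map_add]
          ring }
    have hu : LocBddAE u := by
      -- With ψ(z) = f(z^2) - 2z f(z), u is half of ψ(y + x) - ψ(x) - ψ(y).
      refine (((h.comp_add_left y).sub h).sub (LocBddAE.of_continuous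
        (continuous_const (y := f (y ^ 2) - 2 * y * f y)))).const_mul (1 / 2) |>.congr fun x => ?_
      have h1 : f ((y + x) ^ 2) = f (y ^ 2) + 2 * f (x * y) + f (x ^ 2) := by
        rw [show (y + x) ^ 2 = y ^ 2 + (2 : ℕ) * (x * y) + x ^ 2 by push_cast; ring,
          map_add, map_add, f.map_nat_mul_real]
        norm_num
      simp only [u, AddMonoidHom.coe_mk, ZeroHom.coe_mk, h1, map_add]
      ring
    have := LocBddAE.map_eq_mul u hu x
    simp only [u, AddMonoidHom.coe_mk, ZeroHom.coe_mk, one_mul] at this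
    rw [this]
    ring
  refine ⟨fun x y => by simp only [map_add]; ring, fun x y => ?_⟩
  linear_combination key x y

theorem cast_choose_add_two (n : ℕ) : ((n + 2).choose n : ℝ) = (n + 2) * (n + 1) / 2 := by
  rw [Nat.choose_symm_add, Nat.cast_choose_two]
  push_cast
  ring

/-! ### The two homogeneous models -/

section AddPowPoly

open Polynomial

/-- The polynomial in `q` which for natural numbers `q` takes the value `f (y (q + z) ^ n)`. -/
noncomputable def addPowPoly (f : ℝ →+ ℝ) (y z : ℝ) (n : ℕ) : ℝ[X] :=
  ∑ m ∈ Finset.range (n + 1), monomial m (n.choose m * f (y * z ^ (n - m)))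

theorem coeff_addPowPoly (f : ℝ →+ ℝ) (y z : ℝ) (n m : ℕ) :
    (addPowPoly f y z n).coeff m = n.choose m * f (y * z ^ (n - m)) := by
  simp only [addPowPoly, finsetSum_coeff, coeff_monomial, Finset.sum_ite_eq', Finset.mem_range]
  split_ifs with h
  · rfl
  · simp [Nat.choose_eq_zero_of_lt (by omega : n < m)]

theorem natDegree_addPowPoly_le (f : ℝ →+ ℝ) (y z : ℝ) (n : ℕ) :
    (addPowPoly f y z n).natDegree ≤ n :=
  natDegree_sum_le_of_forall_le _ _ fun _ hm =>
    (natDegree_monomial_le _).trans (Nat.lt_succ_iff.1 (Finset.mem_range.1 hm))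

theorem eval_addPowPoly (f : ℝ →+ ℝ) (y z : ℝ) (n q : ℕ) :
    (addPowPoly f y z n).eval (q : ℝ) = f (y * (q + z) ^ n) := by
  simp only [addPowPoly, eval_finsetSum, eval_monomial]
  rw [add_pow, Finset.mul_sum, map_sum]
  refine Finset.sum_congr rfl fun m _ => ?_
  rw [show y * ((q : ℝ) ^ m * z ^ (n - m) * (n.choose m : ℝ)) =
    ((n.choose m * q ^ m : ℕ) : ℝ) * (y * z ^ (n - m)) by push_cast; ring, f.map_nat_mul_real]
  push_cast
  ring

/-- If `f (z ^ n) - z ^ (n - 1) g z` is bounded on a set of positive measure, `n ≥ 2`, then `f` is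
a derivation up to a linear function. -/
theorem isRealDerivation_of_bddOn_pow (f g : ℝ →+ ℝ) (n : ℕ) {A : Set ℝ} (hA : IsCompact A)
    (hpos : 0 < volume A) (h0 : (0 : ℝ) ∉ A)
    (h : BddOn A fun z => f (z ^ (n + 2)) - z ^ (n + 1) * g z) :
    IsRealDerivation fun x => f x - f 1 * x := by
  have h1 : LocBddAE fun z => f (z ^ (n + 2)) - z ^ (n + 1) * g z :=
    LocBddAE.of_ae_le (h.ae_le_of_homogeneous hA hpos h0 (n + 2) fun r x _ _ => by
      rw [mul_pow, ← Rat.cast_pow, f.map_rat_mul_real, g.map_rat_mul_real]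
      push_cast
      ring)
  -- Here g(q + z) = (q + z) g(1) + (g(z) - z g(1)), so only powers of X + z occur.
  let p : ℝ → ℝ[X] := fun z => addPowPoly f 1 z (n + 2) -
    ((X + C z) ^ (n + 2) * C (g 1) + (X + C z) ^ (n + 1) * C (g z - z * g 1))
  have hp : ∀ z, (p z).natDegree ≤ n + 2 := fun z => by
    refine (natDegree_sub_le_of_le (natDegree_addPowPoly_le _ _ _ _) (n := n + 2) ?_).trans
      (max_self _).le
    compute_degree
  have hpe : ∀ q : ℕ, LocBddAE fun z => (p z).eval (q : ℝ) := fun q =>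
    (h1.comp_add_left q).congr fun z => by
      have : g (q + z) = q * g 1 + g z := by
        rw [map_add]
        simpa using g.map_nat_mul_real q 1
      simp only [p, eval_sub, eval_addPowPoly, this, one_mul, eval_add, eval_mul, eval_pow, eval_X,
        eval_C]
      ring
  have hc1 := LocBddAE.coeff hp hpe (n + 1)
  have hc2 := LocBddAE.coeff hp hpe n
  have hch : ((n + 2).choose n : ℝ) = (n + 2) * (n + 1) / 2 := cast_choose_add_two n
  have hn : ((n : ℝ) + 2) * (n + 1) ≠ 0 := by positivity
  refine isRealDerivation_of_locBddAE f ?_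
  -- Subtracting (n + 1) z times coefficient n + 1 from coefficient n cancels g(z).
  refine ((hc2.sub (((LocBddAE.of_continuous continuous_id).const_mul ((n : ℝ) + 1)).mul hc1)).sub
    (LocBddAE.of_continuous (φ := fun z : ℝ => z ^ 2 * ((n + 2) * (n + 1) / 2) * g 1)
      (by fun_prop))).const_mul (2 / (((n : ℝ) + 2) * (n + 1))) |>.congr fun z => ?_
  simp only [p, coeff_sub, coeff_add, coeff_addPowPoly, coeff_mul_C, coeff_X_add_C_pow, hch,
    Nat.choose_succ_self_right, id]
  rw [show n + 2 - (n + 1) = 1 by omega, show n + 2 - n = 2 by omega,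
    show n + 1 - n = 1 by omega, Nat.choose_self]
  simp only [one_mul, pow_one, Nat.sub_self, pow_zero]
  push_cast
  field_simp
  ring

/-- If `f (z ^ n) - z ^ (n + 1) g (1 / z)` is bounded on a set of positive measure, `n ≥ 1`, then
`f` is a derivation up to a linear function. -/
theorem isRealDerivation_of_bddOn_pow_inv (f g : ℝ →+ ℝ) (n : ℕ) {A : Set ℝ} (hA : IsCompact A)
    (hpos : 0 < volume A) (h0 : (0 : ℝ) ∉ A)
    (h : BddOn A fun z => f (z ^ (n + 1)) - z ^ (n + 2) * g z⁻¹) :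
    IsRealDerivation fun x => f x - f 1 * x := by
  have h1 : LocBddAE fun z => f (z ^ (n + 1)) - z ^ (n + 2) * g z⁻¹ :=
    LocBddAE.of_ae_le (h.ae_le_of_homogeneous hA hpos h0 (n + 1) fun r x hr _ => by
      have hr' : (r : ℝ) ≠ 0 := by exact_mod_cast hr
      rw [mul_pow, mul_pow, mul_inv, ← Rat.cast_pow, f.map_rat_mul_real, ← Rat.cast_inv,
        g.map_rat_mul_real]
      push_cast
      field_simp
      ring)
  -- With ψ the defect, p(q) = q ψ(z(q + z)) + z^(n+2) ψ(q + z) - (q + z)^(n+2) ψ(z); g cancels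
  -- because q/(z(q + z)) = 1/z - 1/(q + z).
  let p : ℝ → ℝ[X] := fun z => X * addPowPoly f (z ^ (n + 1)) z (n + 1) +
    (C (z ^ (n + 2)) * addPowPoly f 1 z (n + 1) - C (f (z ^ (n + 1))) * (X + C z) ^ (n + 2))
  have hp : ∀ z, (p z).natDegree ≤ n + 2 := fun z => by
    refine natDegree_add_le_of_degree_le ?_ ((natDegree_sub_le_of_le (m := n + 2) (n := n + 2)
      ?_ ?_).trans (max_self _).le)
    · exact (natDegree_mul_le_of_le natDegree_X_le (natDegree_addPowPoly_le _ _ _ _)).trans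
        (by omega)
    · exact (natDegree_C_mul_le _ _).trans ((natDegree_addPowPoly_le _ _ _ _).trans (by omega))
    · compute_degree
  have hpe : ∀ q : ℕ, LocBddAE fun z => (p z).eval (q : ℝ) := fun q => by
    have hw := h1.comp_of_preimage_null (T := fun z => z * (q + z)) (by fun_prop)
      (volume_preimage_mul_add_self_null q)
    refine ((hw.const_mul q).add (((LocBddAE.of_continuous (continuous_pow (n + 2))).mul
      (h1.comp_add_left q)).sub ((LocBddAE.of_continuous (φ := fun z : ℝ => (q + z) ^ (n + 2))
        (by fun_prop)).mul h1))).congr_ae ?_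
    filter_upwards [Measure.ae_ne volume (0 : ℝ), Measure.ae_ne volume (-q : ℝ)] with z hz hqz
    have hqz' : (q : ℝ) + z ≠ 0 := fun h => hqz (by linarith)
    have hg : q * g (z * (q + z))⁻¹ = g z⁻¹ - g (q + z)⁻¹ := by
      rw [← g.map_nat_mul_real, ← map_sub]
      congr 1
      field_simp
      ring
    simp only [p, eval_sub, eval_addPowPoly, one_mul, eval_add, eval_mul, eval_pow, eval_X,
        eval_C]
    simp only [mul_pow]
    linear_combination (-(z ^ (n + 2) * (q + z) ^ (n + 2))) * hg
  have hQ : LocBddAE fun z => (n + 1) * f (z ^ (n + 2)) - (n + 2) * z * f (z ^ (n + 1)) := by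
    refine ((LocBddAE.coeff hp hpe (n + 1)).sub (LocBddAE.of_continuous
      (φ := fun z : ℝ => z ^ (n + 2) * f 1) (by fun_prop))).congr fun z => ?_
    simp only [p, coeff_sub, coeff_add, coeff_X_mul, coeff_addPowPoly, coeff_C_mul,
      coeff_X_add_C_pow, Nat.choose_succ_self_right]
    rw [show n + 1 - n = 1 by omega, show n + 2 - (n + 1) = 1 by omega, Nat.choose_self,
      Nat.sub_self, pow_one, ← pow_succ, pow_zero, mul_one]
    push_cast
    ring
  refine isRealDerivation_of_locBddAE f ?_
  rcases n with _ | n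
  · refine hQ.congr fun z => ?_
    norm_num
  -- A second shift z ↦ q + z, applied to `hQ`; coefficient n + 1 is a multiple of f(z^2) - 2z f(z).
  let p' : ℝ → ℝ[X] := fun z => C ((n : ℝ) + 2) * addPowPoly f 1 z (n + 3) -
    C ((n : ℝ) + 3) * (X * addPowPoly f 1 z (n + 2) + C z * addPowPoly f 1 z (n + 2))
  have hp' : ∀ z, (p' z).natDegree ≤ n + 3 := fun z => by
    refine (natDegree_sub_le_of_le (m := n + 3) (n := n + 3) ?_ ?_).trans (max_self _).le
    · exact (natDegree_C_mul_le _ _).trans (natDegree_addPowPoly_le _ _ _ _)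
    · refine (natDegree_C_mul_le _ _).trans (natDegree_add_le_of_degree_le ?_ ?_)
      · exact (natDegree_mul_le_of_le natDegree_X_le (natDegree_addPowPoly_le _ _ _ _)).trans
          (by omega)
      · exact (natDegree_C_mul_le _ _).trans ((natDegree_addPowPoly_le _ _ _ _).trans (by omega))
  have hpe' : ∀ q : ℕ, LocBddAE fun z => (p' z).eval (q : ℝ) := fun q =>
    (hQ.comp_add_left q).congr fun z => by
      simp only [p', eval_sub, eval_addPowPoly, one_mul, eval_add, eval_mul, eval_X, eval_C]
      push_cast
      ring
  have hn : ((n : ℝ) + 3) * (n + 2) ≠ 0 := by positivity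
  refine ((LocBddAE.coeff hp' hpe' (n + 1)).const_mul (2 / (((n : ℝ) + 3) * (n + 2)))).congr
    fun z => ?_
  simp only [p', coeff_sub, coeff_add, coeff_C_mul, coeff_X_mul, coeff_addPowPoly,
    cast_choose_add_two, Nat.choose_succ_self_right,
    show (n + 3).choose (n + 1) = ((n + 1) + 2).choose (n + 1) from rfl]
  rw [show n + 3 - (n + 1) = 2 by omega, show n + 2 - n = 2 by omega,
    show n + 2 - (n + 1) = 1 by omega, pow_one]
  push_cast
  field_simp
  ring

end AddPowPoly

/-! ### The inhomogeneous model -/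

namespace BddOn

variable {A : Set ℝ} {φ ψ : ℝ → ℝ}

theorem congr (h : BddOn A φ) (he : ∀ x ∈ A, φ x = ψ x) : BddOn A ψ := by
  obtain ⟨C, hC⟩ := h
  exact ⟨C, fun x hx => by rw [← he x hx]; exact hC x hx⟩

theorem of_continuousOn (hA : IsCompact A) (h : ContinuousOn φ A) : BddOn A φ :=
  hA.exists_bound_of_continuousOn h

theorem add (h1 : BddOn A φ) (h2 : BddOn A ψ) : BddOn A fun x => φ x + ψ x := by
  obtain ⟨C1, hC1⟩ := h1
  obtain ⟨C2, hC2⟩ := h2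
  exact ⟨C1 + C2, fun x hx => (abs_add_le _ _).trans (add_le_add (hC1 x hx) (hC2 x hx))⟩

theorem mul (h1 : BddOn A φ) (h2 : BddOn A ψ) : BddOn A fun x => φ x * ψ x := by
  obtain ⟨C1, hC1⟩ := h1
  obtain ⟨C2, hC2⟩ := h2
  refine ⟨C1 * C2, fun x hx => ?_⟩
  rw [abs_mul]
  exact mul_le_mul (hC1 x hx) (hC2 x hx) (abs_nonneg _) ((abs_nonneg _).trans (hC1 x hx))

theorem const (A : Set ℝ) (c : ℝ) : BddOn A fun _ => c := ⟨|c|, fun _ _ => le_rfl⟩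

theorem image {T : ℝ → ℝ} (h : BddOn A fun x => φ (T x)) : BddOn (T '' A) φ := by
  obtain ⟨C, hC⟩ := h
  refine ⟨C, ?_⟩
  rintro _ ⟨x, hx, rfl⟩
  exact hC x hx

end BddOn

theorem zero_notMem_of_one_sign {A : Set ℝ} (h : A ⊆ Set.Ioi 0 ∨ A ⊆ Set.Iio 0) : (0 : ℝ) ∉ A :=
  fun h0 => h.elim (fun h => (lt_irrefl (0 : ℝ)) (h h0)) fun h => (lt_irrefl (0 : ℝ)) (h h0)

theorem injOn_pow_of_one_sign {A : Set ℝ} (h : A ⊆ Set.Ioi 0 ∨ A ⊆ Set.Iio 0) (n : ℕ) :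
    Set.InjOn (fun x : ℝ => x ^ (n + 1)) A := by
  intro x hx y hy hxy
  simp only at hxy
  rcases h with h | h
  · exact (pow_left_inj₀ (h hx).le (h hy).le n.succ_ne_zero).1 hxy
  · refine neg_injective ((pow_left_inj₀ (neg_pos.2 (h hx)).le (neg_pos.2 (h hy)).le
      n.succ_ne_zero).1 ?_)
    rw [neg_pow, neg_pow y, hxy]

/-- If `f (1 / (x ^ n + δ)) - x ^ (n - 1) g x / (x ^ n + δ) ^ 2` is bounded on a set of positive
measure, `n ≥ 1` and `δ ≠ 0` rational, then `f` is a derivation up to a linear function. -/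
theorem isRealDerivation_of_bddOn_inv_pow_add (f g : ℝ →+ ℝ) (n : ℕ) {δ : ℚ} (hδ : δ ≠ 0)
    {A : Set ℝ} (hA : IsCompact A) (hpos : 0 < volume A) (hs : A ⊆ Set.Ioi 0 ∨ A ⊆ Set.Iio 0)
    (hne : ∀ x ∈ A, x ^ (n + 1) + (δ : ℝ) ≠ 0)
    (h : BddOn A fun x => f (x ^ (n + 1) + δ)⁻¹ - x ^ n * g x / (x ^ (n + 1) + δ) ^ 2) :
    IsRealDerivation fun x => f x - f 1 * x := by
  obtain ⟨q, hq, hq1, hqpos⟩ := exists_rat_dilation_inter_pos hA hpos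
  set B := A ∩ (fun x => (q : ℝ) * x) ⁻¹' A with hB
  have hBc : IsCompact B := hA.inter_right (hA.isClosed.preimage (by fun_prop))
  have hBA : B ⊆ A := Set.inter_subset_left
  have h0 := zero_notMem_of_one_sign hs
  have hqR : (q : ℝ) ≠ 0 := by exact_mod_cast hq.ne'
  obtain ⟨e, he⟩ : ∃ e : ℚ, e = δ * ((q ^ (n + 1))⁻¹ - 1) := ⟨_, rfl⟩
  have he0 : e ≠ 0 := by
    rw [he]
    refine mul_ne_zero hδ fun h1 => hq1 ?_
    rw [sub_eq_zero, inv_eq_one] at h1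
    exact (pow_eq_one_iff_of_nonneg hq.le n.succ_ne_zero).1 h1
  have he0' : (e : ℝ) ≠ 0 := by exact_mod_cast he0
  have heR : (e : ℝ) = δ * (((q : ℝ) ^ (n + 1))⁻¹ - 1) := by
    exact_mod_cast congrArg (Rat.cast (K := ℝ)) he
  have hY' : ∀ x : ℝ, x ^ (n + 1) + δ + e = ((q * x) ^ (n + 1) + δ) / (q : ℝ) ^ (n + 1) := fun x => by
    rw [heR, mul_pow]
    field_simp
    ring
  have hY'0 : ∀ x ∈ B, x ^ (n + 1) + (δ : ℝ) + e ≠ 0 := fun x hx => by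
    rw [hY']
    exact div_ne_zero (hne _ hx.2) (pow_ne_zero _ hqR)
  set m : ℝ → ℝ := fun x => 1 + e / (x ^ (n + 1) + δ) with hm
  have hm' : ∀ x ∈ B, m x = (x ^ (n + 1) + δ + e) / (x ^ (n + 1) + δ) := fun x hx => by
    have := hne x (hBA hx)
    simp only [hm]
    field_simp
  have hm0 : ∀ x ∈ B, m x ≠ 0 := fun x hx => by
    rw [hm' x hx]
    exact div_ne_zero (hY'0 x hx) (hne x (hBA hx))
  have hmc : ContinuousOn m B := by
    refine continuousOn_const.add (continuousOn_const.div (by fun_prop) fun x hx => hne x (hBA hx))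
  have hMpos : 0 < volume (m '' B) := by
    refine volume_image_pos (T' := fun x => -(e * ((n + 1) * x ^ n)) / (x ^ (n + 1) + δ) ^ 2)
      hBc.measurableSet hqpos (fun x hx => ?_) (fun x hx => ?_) (fun x hx y hy hxy => ?_)
    · have h1 : HasDerivAt (fun x : ℝ => x ^ (n + 1) + (δ : ℝ)) ((n + 1) * x ^ n) x := by
        simpa using (hasDerivAt_pow (n + 1) x).add_const (δ : ℝ)
      have h2 := ((hasDerivAt_const x (e : ℝ)).fun_div h1 (hne x (hBA hx))).const_add 1
      simpa [hm] using h2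
    · have hx0 : x ≠ 0 := fun h => h0 (h ▸ hBA hx)
      refine div_ne_zero (neg_ne_zero.2 (mul_ne_zero he0' (mul_ne_zero (by positivity)
        (pow_ne_zero _ hx0)))) (pow_ne_zero _ (hne x (hBA hx)))
    · refine injOn_pow_of_one_sign hs n (hBA hx) (hBA hy) ?_
      simp only [hm, add_right_inj] at hxy
      rw [div_eq_div_iff (hne x (hBA hx)) (hne y (hBA hy)), mul_right_inj' he0'] at hxy
      simp only
      linarith
  have hM0 : (0 : ℝ) ∉ m '' B := by
    rintro ⟨x, hx, h⟩
    exact hm0 x hx h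
  -- Since m = 1 + e/Y and 1/m = 1 - e/(Y + e), f(m) + m^2 f(1/m) is built from the defects at x and
  -- qx, with weights that cancel g(x).
  refine isRealDerivation_of_bddOn_pow_inv f (-f) 0 (hBc.image_of_continuousOn hmc) hMpos hM0
    (BddOn.image ?_)
  obtain ⟨C, hC⟩ := h
  have hb1 : BddOn B fun x => f (x ^ (n + 1) + δ)⁻¹ - x ^ n * g x / (x ^ (n + 1) + δ) ^ 2 :=
    ⟨C, fun x hx => hC x hx.1⟩
  have hb2 : BddOn B fun x => f ((q * x) ^ (n + 1) + δ)⁻¹ -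
      (q * x) ^ n * g (q * x) / ((q * x) ^ (n + 1) + δ) ^ 2 := ⟨C, fun x hx => hC _ hx.2⟩
  have hmB : BddOn B fun x => m x ^ 2 := BddOn.of_continuousOn hBc (hmc.pow 2)
  refine ((((BddOn.const B 1).add hmB).mul (BddOn.const B (f 1))).add
    (((hmB.mul hb2).mul (BddOn.const B (-e * q ^ (n + 1)))).add
    (hb1.mul (BddOn.const B e)))).congr fun x hx => ?_
  have hY := hne x (hBA hx)
  have hYe := hY'0 x hx
  have hf1 : f (m x) = f 1 + e * f (x ^ (n + 1) + δ)⁻¹ := by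
    simp only [hm, div_eq_mul_inv, map_add, f.map_rat_mul_real]
  have hf2 : f (m x)⁻¹ = f 1 - e * f (x ^ (n + 1) + δ + e)⁻¹ := by
    rw [← f.map_rat_mul_real, ← map_sub, hm' x hx]
    congr 1
    field_simp
    ring
  have hf3 : f ((q * x) ^ (n + 1) + δ)⁻¹ = ((q : ℝ) ^ (n + 1))⁻¹ * f (x ^ (n + 1) + δ + e)⁻¹ := by
    rw [← Rat.cast_pow, ← Rat.cast_inv, ← f.map_rat_mul_real, hY']
    congr 1
    push_cast
    field_simp
  have hqY : (q * x) ^ (n + 1) + (δ : ℝ) = q ^ (n + 1) * (x ^ (n + 1) + δ + e) := by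
    rw [hY']
    field_simp
  rw [hf3, hqY, g.map_rat_mul_real]
  simp only [zero_add, pow_one, AddMonoidHom.neg_apply]
  rw [hf1, hf2, hm' x hx]
  generalize f (x ^ (n + 1) + δ + e)⁻¹ = u
  generalize f (x ^ (n + 1) + δ)⁻¹ = v
  have e1 : (q * x : ℝ) ^ n * (q * g x) / (q ^ (n + 1) * (x ^ (n + 1) + δ + e)) ^ 2 =
    ((q : ℝ) ^ (n + 1))⁻¹ * (x ^ n * g x / (x ^ (n + 1) + δ + e) ^ 2) := by
    rw [mul_pow]
    field_simp
    ring
  rw [e1, ← mul_sub]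
  generalize x ^ (n + 1) + (δ : ℝ) = Y at *
  field_simp
  ring

/-! ### Reduction to the three models -/

theorem isRealDerivation_of_bddOn_nat (f g : ℝ →+ ℝ) (n : ℕ) {a b c d : ℚ}
    (hdet : a * d - b * c ≠ 0) (hc : c = 0 → n ≠ 0) {A : Set ℝ} (hA : IsCompact A)
    (hpos : 0 < volume A) (hs : A ⊆ Set.Ioi 0 ∨ A ⊆ Set.Iio 0)
    (hne : ∀ x ∈ A, (c : ℝ) * x ^ (n + 1) + d ≠ 0)
    (h : BddOn A fun x => f ((a * x ^ (n + 1) + b) / (c * x ^ (n + 1) + d)) -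
      x ^ n * g x / (c * x ^ (n + 1) + d) ^ 2) :
    IsRealDerivation fun x => f x - f 1 * x := by
  have h0 := zero_notMem_of_one_sign hs
  have hx0 : ∀ x ∈ A, x ≠ 0 := fun x hx h => h0 (h ▸ hx)
  by_cases hc0 : c = 0
  · obtain ⟨N, rfl⟩ := Nat.exists_eq_succ_of_ne_zero (hc hc0)
    subst hc0
    have had : a ≠ 0 ∧ d ≠ 0 := by
      rw [mul_zero, sub_zero] at hdet
      exact mul_ne_zero_iff.1 hdet
    have ha : (a : ℝ) ≠ 0 := by exact_mod_cast had.1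
    have hd : (d : ℝ) ≠ 0 := by exact_mod_cast had.2
    refine isRealDerivation_of_bddOn_pow f ((AddMonoidHom.mulLeft (a * d : ℝ)⁻¹).comp g) N hA hpos
      h0 (((h.add (BddOn.const A (-f (b / d)))).mul (BddOn.const A (d / a))).congr fun x hx => ?_)
    have h1 : f ((a * x ^ (N + 1 + 1) + b) / (((0 : ℚ) : ℝ) * x ^ (N + 1 + 1) + d)) =
        a / d * f (x ^ (N + 2)) + f (b / d) := by
      rw [← Rat.cast_div, ← f.map_rat_mul_real, ← map_add]
      congr 1
      push_cast
      rw [zero_mul, zero_add]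
      field_simp
    simp only [Nat.succ_eq_add_one, h1, AddMonoidHom.comp_apply, AddMonoidHom.coe_mulLeft]
    rw [Rat.cast_zero, zero_mul, zero_add]
    generalize f (x ^ (N + 2)) = u
    field_simp
    ring
  have hcR : (c : ℝ) ≠ 0 := by exact_mod_cast hc0
  by_cases hd0 : d = 0
  · subst hd0
    have hb : (b : ℝ) ≠ 0 := by
      rintro hb
      have : b = 0 := by exact_mod_cast hb
      simp [this] at hdet
    have hinv : ContinuousOn (fun x : ℝ => x⁻¹) A := continuousOn_inv₀.mono hx0
    refine isRealDerivation_of_bddOn_pow_inv f ((AddMonoidHom.mulLeft (b * c : ℝ)⁻¹).comp g) n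
      (hA.image_of_continuousOn hinv) (volume_image_pos hA.measurableSet hpos
        (fun x hx => hasDerivAt_inv (hx0 x hx))
        (fun x hx => neg_ne_zero.2 (inv_ne_zero (pow_ne_zero 2 (hx0 x hx)))) inv_injective.injOn)
      (by rintro ⟨x, hx, h⟩; exact hx0 x hx (inv_eq_zero.1 h))
      (BddOn.image (((h.add (BddOn.const A (-f (a / c)))).mul
        (BddOn.const A (c / b))).congr fun x hx => ?_))
    have hx := hx0 x hx
    have h1 : f ((a * x ^ (n + 1) + b) / (c * x ^ (n + 1) + ((0 : ℚ) : ℝ))) =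
        b / c * f ((x⁻¹) ^ (n + 1)) + f (a / c) := by
      rw [← Rat.cast_div, ← f.map_rat_mul_real, ← map_add]
      congr 1
      push_cast
      rw [add_zero, inv_pow]
      field_simp
      ring
    simp only [h1, AddMonoidHom.comp_apply, AddMonoidHom.coe_mulLeft, inv_inv]
    rw [Rat.cast_zero, add_zero]
    generalize f ((x⁻¹) ^ (n + 1)) = u
    rw [inv_pow]
    field_simp
    ring
  -- Partial fractions: the quotient is a/c + ((bc - ad)/c^2) / (x^(n+1) + d/c).
  · have hδ : d / c ≠ 0 := div_ne_zero hd0 hc0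
    have hdetR : (b * c - a * d : ℝ) ≠ 0 := fun h1 => hdet (by
      have : (b * c - a * d : ℚ) = 0 := by exact_mod_cast h1
      linarith)
    have hne' : ∀ x ∈ A, x ^ (n + 1) + ((d / c : ℚ) : ℝ) ≠ 0 := fun x hx h1 => hne x hx (by
      push_cast at h1
      field_simp at h1
      linarith)
    refine isRealDerivation_of_bddOn_inv_pow_add f
      ((AddMonoidHom.mulLeft (b * c - a * d : ℝ)⁻¹).comp g) n hδ hA hpos hs hne'
      (((h.add (BddOn.const A (-f (a / c)))).mul
        (BddOn.const A (c ^ 2 / (b * c - a * d)))).congr fun x hx => ?_)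
    have hY := hne' x hx
    have hX := hne x hx
    have hXY : (c : ℝ) * x ^ (n + 1) + d = c * (x ^ (n + 1) + ((d / c : ℚ) : ℝ)) := by
      push_cast
      field_simp
    have h1 : f ((a * x ^ (n + 1) + b) / (c * x ^ (n + 1) + d)) =
        (b * c - a * d) / c ^ 2 * f (x ^ (n + 1) + ((d / c : ℚ) : ℝ))⁻¹ + f (a / c) := by
      rw [show ((b * c - a * d) / c ^ 2 : ℝ) = (((b * c - a * d) / c ^ 2 : ℚ) : ℝ) by push_cast; rfl,
        ← f.map_rat_mul_real, ← map_add]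
      congr 1
      rw [hXY]
      have : (d : ℝ) = c * ((d / c : ℚ) : ℝ) := by
        push_cast
        field_simp
      push_cast
      rw [this]
      generalize ((d / c : ℚ) : ℝ) = δ at *
      field_simp
      ring
    rw [h1, hXY]
    simp only [AddMonoidHom.comp_apply, AddMonoidHom.coe_mulLeft]
    generalize f (x ^ (n + 1) + ((d / c : ℚ) : ℝ))⁻¹ = u
    generalize x ^ (n + 1) + ((d / c : ℚ) : ℝ) = Y at *
    field_simp
    ring

/-! ### From f to g -/

/-- A derivation of the real line, as a `Derivation` over `ℚ`. -/
noncomputable def IsRealDerivation.toDerivation {F : ℝ → ℝ} (h : IsRealDerivation F) :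
    Derivation ℚ ℝ ℝ :=
  Derivation.mk' (AddMonoidHom.toRatLinearMap (AddMonoidHom.mk' F h.1)) fun x y => by
    simp [h.2 x y, mul_comm]

theorem IsRealDerivation.map_ratio {F : ℝ → ℝ} (h : IsRealDerivation F) (a b c d : ℚ) (n : ℤ)
    (x : ℝ) (hx : (c : ℝ) * x ^ n + d ≠ 0) :
    F ((a * x ^ n + b) / (c * x ^ n + d)) =
      (a * d - b * c) * n * x ^ (n - 1) * F x / (c * x ^ n + d) ^ 2 := by
  have hD : ∀ y, F y = h.toDerivation y := fun y => rfl
  have hq : ∀ r : ℚ, h.toDerivation (r : ℝ) = 0 := fun r => h.toDerivation.map_algebraMap r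
  rw [hD, hD, Derivation.leibniz_div]
  simp only [map_add, Derivation.leibniz, hq, Derivation.leibniz_zpow, smul_eq_mul, zsmul_eq_mul]
  field_simp
  ring

theorem isRealDerivation_right (f g : ℝ →+ ℝ) (n : ℤ) (a b c d : ℚ) {A : Set ℝ} (hA : IsCompact A)
    (hpos : 0 < volume A) (h0 : (0 : ℝ) ∉ A) (hne : ∀ x ∈ A, (c : ℝ) * x ^ n + d ≠ 0)
    (h : BddOn A fun x => f ((a * x ^ n + b) / (c * x ^ n + d)) -
      x ^ (n - 1) * g x / (c * x ^ n + d) ^ 2)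
    (hF : IsRealDerivation fun x => f x - f 1 * x) :
    IsRealDerivation fun x => g x - g 1 * x := by
  have hx0 : ∀ x ∈ A, x ≠ 0 := fun x hx h => h0 (h ▸ hx)
  have hcont : ∀ (m : ℤ) (r s : ℝ), ContinuousOn (fun x : ℝ => r * x ^ m + s) A := fun m r s =>
    (continuousOn_const.mul (continuousOn_id.zpow₀ m fun x hx => Or.inl (hx0 x hx))).add
      continuousOn_const
  set κ : ℝ := (a * d - b * c) * n with hκ
  let F : ℝ →+ ℝ := AddMonoidHom.mk' (fun x => f x - f 1 * x) hF.1
  have hFv : ∀ x, F x = f x - f 1 * x := fun x => rfl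
  let u : ℝ →+ ℝ := (AddMonoidHom.mulLeft κ).comp F - g
  have huv : ∀ x, u x = κ * F x - g x := fun x => rfl
  have hu : BddOn A u := by
    -- Remove the linear part of f, then multiply by (cx^n + d)^2 x^(1-n) to isolate κF - g.
    refine ((h.add (BddOn.of_continuousOn hA (((hcont n a b).div (hcont n c d) hne).const_smul
      (-f 1)))).mul (BddOn.of_continuousOn hA
        (((hcont n c d).pow 2).mul (hcont (1 - n) 1 0)))).congr fun x hx => ?_
    have h1 : f ((a * x ^ n + b) / (c * x ^ n + d)) = _ :=
      sub_eq_iff_eq_add.1 (hF.map_ratio a b c d n x (hne x hx))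
    have h2 : x ^ (n - 1) * x ^ (1 - n) = 1 := by
      rw [← zpow_add₀ (hx0 x hx)]
      simp
    have hX := hne x hx
    simp only [Pi.smul_apply, Pi.pow_apply, Pi.mul_apply, Pi.div_apply, smul_eq_mul, huv, hFv]
    rw [h1]
    field_simp
    linear_combination ((a * d - b * c) * n * (f x - f 1 * x) - g x) * h2
  have hlin := BddOn.map_eq_mul hA hpos h0 u hu
  have hg : ∀ x, g x - g 1 * x = κ * F x := fun x => by
    have h1 := hlin x
    have h2 : F 1 = 0 := by simp [hFv]
    rw [huv, huv, h2] at h1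
    linarith
  refine ⟨fun x y => ?_, fun x y => ?_⟩
  · simp only
    rw [hg, hg, hg, map_add]
    ring
  · simp only [hg]
    have := hF.2 x y
    simp only [← hFv] at this
    rw [this]
    ring

/-! ### Both signs of the exponent, and the conclusion -/

theorem isRealDerivation_left (f g : ℝ →+ ℝ) {n : ℤ} (hn : n ≠ 0) {a b c d : ℚ}
    (hdet : a * d - b * c ≠ 0) (hc : c = 0 → n ≠ 1) (hd : d = 0 → n ≠ -1) {A : Set ℝ}
    (hA : IsCompact A) (hpos : 0 < volume A) (hs : A ⊆ Set.Ioi 0 ∨ A ⊆ Set.Iio 0)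
    (hne : ∀ x ∈ A, (c : ℝ) * x ^ n + d ≠ 0)
    (h : BddOn A fun x => f ((a * x ^ n + b) / (c * x ^ n + d)) -
      x ^ (n - 1) * g x / (c * x ^ n + d) ^ 2) :
    IsRealDerivation fun x => f x - f 1 * x := by
  have h0 := zero_notMem_of_one_sign hs
  rcases lt_or_gt_of_ne hn with hneg | hgt
  -- Multiplying through by x^(m+1) swaps the columns of the matrix, so the exclusion n ≠ -1 for d =
  -- 0 becomes that of exponent 1 for c = 0.
  · obtain ⟨m, rfl⟩ : ∃ m : ℕ, n = -((m : ℤ) + 1) := ⟨(-n - 1).toNat, by omega⟩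
    have hpow : ∀ x : ℝ, x ^ (-((m : ℤ) + 1)) = (x ^ (m + 1))⁻¹ := fun x => by
      rw [zpow_neg]
      norm_cast
    have hswap : ∀ x ∈ A, ∀ r s : ℚ, (r : ℝ) * x ^ (-((m : ℤ) + 1)) + s =
        (s * x ^ (m + 1) + r) / x ^ (m + 1) := fun x hx r s => by
      have hx0 : x ≠ 0 := fun h => h0 (h ▸ hx)
      rw [hpow]
      field_simp
      ring
    have hne' : ∀ x ∈ A, (d : ℝ) * x ^ (m + 1) + c ≠ 0 := fun x hx h1 => hne x hx (by
      rw [hswap x hx, h1, zero_div])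
    refine isRealDerivation_of_bddOn_nat f g m (a := b) (b := a) (c := d) (d := c)
      (fun h1 => hdet (by linarith)) (fun hd0 hm => hd hd0 (by simp [hm])) hA hpos hs hne'
      (h.congr fun x hx => ?_)
    have hx0 : x ≠ 0 := fun h => h0 (h ▸ hx)
    have hX := hne' x hx
    have h1 : x ^ (-((m : ℤ) + 1) - 1) = (x ^ (m + 2))⁻¹ := by
      rw [show -((m : ℤ) + 1) - 1 = -((m + 2 : ℕ) : ℤ) by push_cast; ring, zpow_neg, zpow_natCast]
    rw [hswap x hx, hswap x hx, div_div_div_cancel_right₀ (pow_ne_zero _ hx0), h1]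
    congr 1
    field_simp
    ring
  · obtain ⟨m, rfl⟩ : ∃ m : ℕ, n = (m : ℤ) + 1 := ⟨(n - 1).toNat, by omega⟩
    have hpow : ∀ x : ℝ, x ^ ((m : ℤ) + 1) = x ^ (m + 1) := fun x => by norm_cast
    refine isRealDerivation_of_bddOn_nat f g m hdet (fun hc0 hm => hc hc0 (by simp [hm])) hA hpos hs
      (fun x hx => by simpa only [hpow] using hne x hx) (h.congr fun x _ => ?_)
    simp only [hpow, add_sub_cancel_right, zpow_natCast]

theorem measurableSet_rationalDomain (M : GL (Fin 2) ℚ) (n : ℤ) :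
    MeasurableSet (rationalDomain M n) := by
  have h1 : Measurable fun x : ℝ => (M 1 0 : ℝ) * x ^ n + (M 1 1 : ℝ) :=
    (measurable_const.mul (measurable_id.pow_const n)).add measurable_const
  refine MeasurableSet.inter ?_ (h1 (measurableSet_singleton 0).compl)
  exact MeasurableSet.imp (MeasurableSet.const _) (measurableSet_singleton 0).compl

theorem det_entries_ne_zero (M : GL (Fin 2) ℚ) : M 0 0 * M 1 1 - M 0 1 * M 1 0 ≠ 0 := by
  have := M.det_ne_zero
  rwa [Matrix.det_fin_two] at this

theorem volume_rationalDomain_pos (M : GL (Fin 2) ℚ) {n : ℤ} (hn : n ≠ 0) :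
    0 < volume (rationalDomain M n) := by
  -- On the positive half-line x ↦ x^n is injective, so the denominator vanishes at most once there.
  have hsub : (Set.Ioi 0 \ rationalDomain M n).Subsingleton := by
    rintro x ⟨hx, hx'⟩ y ⟨hy, hy'⟩
    have key : ∀ z : ℝ, 0 < z → z ∉ rationalDomain M n →
        (M 1 0 : ℝ) * z ^ n + (M 1 1 : ℝ) = 0 := fun z hz hz' => by
      by_contra hne
      exact hz' ⟨fun _ => hz.ne', hne⟩
    have h1 := key x hx hx'
    have h2 := key y hy hy'
    by_cases hc : M 1 0 = 0
    · have hd : M 1 1 = 0 := by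
        rw [hc] at h1
        simpa using h1
      exact absurd (by rw [hc, hd]; ring) (det_entries_ne_zero M)
    · have hcR : (M 1 0 : ℝ) ≠ 0 := by exact_mod_cast hc
      have h3 : x ^ n = y ^ n := mul_left_cancel₀ hcR (by linarith)
      exact (zpow_left_inj₀ (le_of_lt hx) (le_of_lt hy) hn).1 h3
  rw [pos_iff_ne_zero]
  intro h0
  have h1 : volume (Set.Ioi (0 : ℝ)) = 0 :=
    measure_mono_null (t := rationalDomain M n ∪ (Set.Ioi 0 \ rationalDomain M n))
      (fun x hx => by by_cases h : x ∈ rationalDomain M n <;> simp_all)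
      (measure_union_null h0 (hsub.measure_zero volume))
  simp at h1

theorem theoremT2p2 (n : ℤ) (hn : n ≠ 0) (M : GL (Fin 2) ℚ)
    (hc : M 1 0 = 0 → n ≠ 1) (hd : M 1 1 = 0 → n ≠ -1)
    (f g : ℝ → ℝ) (hf : ∀ x y, f (x + y) = f x + f y) (hg : ∀ x y, g (x + y) = g x + g y)
    (hφ : IsGloballyRegularOn (rationalDefect M n f g) (rationalDomain M n)) :
    IsRealDerivation (fun x => f x - f 1 * x) ∧
      IsRealDerivation (fun x => g x - g 1 * x) := by
  obtain ⟨K, hKD, hK, hpos, hs, hb⟩ := exists_compact_bddOn_of_isGloballyRegularOn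
    (measurableSet_rationalDomain M n) (volume_rationalDomain_pos M hn) hφ
  have hF := isRealDerivation_left (AddMonoidHom.mk' f hf) (AddMonoidHom.mk' g hg) hn
    (det_entries_ne_zero M) hc hd hK hpos hs (fun x hx => (hKD hx).2) hb
  exact ⟨hF, isRealDerivation_right (AddMonoidHom.mk' f hf) (AddMonoidHom.mk' g hg) n _ _ _ _ hK
    hpos (zero_notMem_of_one_sign hs) (fun x hx => (hKD hx).2) hb hF⟩
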